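/- There are absolute constants $C$ and $K$ such that the following holds for all integers $n \ge 2$, all real $m > 0$, all innate opinion vectors $s \in [0,1]^n$ and all $\epsilon \in (0,1]$. For an undirected weighted graph $G$ on $\{1,\dots,n\}$ with edge set $E$, positive edge weights $w_{uv}$, no loops and combinatorial Laplacian $L$, let $z^* = (I+L)^{-1}s$ be the Friedkin--Johnsen equilibrium and $\bar z = z^* - \frac{\vec 1^{T} z^*}{n}\vec 1$ its mean-centered version. The polarization-disagreement index of $G$ is $$\mathcal I_{G,s} = \sum_{u} \bar z_u^2 + \sum_{\{u,v\}\in E} w_{uv}(z^*_u - z^*_v)^2 .$$ Let $\mathrm{OPT}$ be the infimum of $\mathcal I_{H,s}$ over all connected weighted graphs $H$ on $\{1,\dots,n\}$ of total edge weight $m$. Then there is a connected weighted graph $G$ on $\{1,\dots,n\}$ of total edge weight $m$ with at most $C\, n\log n/\epsilon^2$ edges such that $$\mathrm{OPT} \le \mathcal I_{G,s} \le (1+\epsilon+K\epsilon^2)\,\mathrm{OPT}.$$ -/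

import Mathlib

open scoped Matrix

/-- A finite undirected weighted graph on the vertex set `V`, without loops: a symmetric matrix of
nonnegative edge weights. The pair `{u, v}` is an edge exactly when its weight is positive. -/
structure WeightedGraph (V : Type*) where
  w : V → V → ℝ
  symm : ∀ u v, w u v = w v u
  nonneg : ∀ u v, 0 ≤ w u v
  loopless : ∀ u, w u u = 0

namespace WeightedGraph

variable {V : Type*}

/-- The underlying simple graph: the pairs of positive weight. -/
def toSimpleGraph (G : WeightedGraph V) : SimpleGraph V where
  Adj u v := 0 < G.w u v
  symm := ⟨fun u v h => by rw [G.symm v u]; exact h⟩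
  loopless := ⟨fun u h => by rw [G.loopless u] at h; exact lt_irrefl _ h⟩

/-- The number of edges (unordered pairs of positive weight). -/
noncomputable def numEdges (G : WeightedGraph V) : ℕ :=
  G.toSimpleGraph.edgeSet.ncard

variable [Fintype V]

/-- The sum of the weights of all edges. The double sum runs over ordered pairs and thus counts
every edge twice. -/
noncomputable def totalWeight (G : WeightedGraph V) : ℝ :=
  (1 / 2) * ∑ u, ∑ v, G.w u v

variable [DecidableEq V]

/-- The combinatorial Laplacian: the diagonal matrix of weighted degrees minus the weights. -/
def laplacian (G : WeightedGraph V) : Matrix V V ℝ :=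
  Matrix.diagonal (fun u => ∑ v, G.w u v) - Matrix.of G.w

/-- The Friedkin-Johnsen equilibrium `z* = (I + L)⁻¹ s` for the innate opinions `s`. -/
noncomputable def equilibrium (G : WeightedGraph V) (s : V → ℝ) : V → ℝ :=
  (1 + G.laplacian)⁻¹ *ᵥ s

/-- The mean-centered equilibrium vector. -/
noncomputable def centeredEquilibrium (G : WeightedGraph V) (s : V → ℝ) : V → ℝ :=
  fun u => G.equilibrium s u - (∑ v, G.equilibrium s v) / (Fintype.card V : ℝ)

/-- Polarization: the sum of the squares of the mean-centered equilibrium opinions. -/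
noncomputable def polarization (G : WeightedGraph V) (s : V → ℝ) : ℝ :=
  ∑ u, (G.centeredEquilibrium s u) ^ 2

/-- Disagreement: the sum over the edges `{u, v}` of `w u v * (z*_u - z*_v) ^ 2`. The double sum
runs over ordered pairs and thus counts every edge twice. -/
noncomputable def disagreement (G : WeightedGraph V) (s : V → ℝ) : ℝ :=
  (1 / 2) * ∑ u, ∑ v, G.w u v * (G.equilibrium s u - G.equilibrium s v) ^ 2

/-- The polarization-disagreement index. -/
noncomputable def pdIndex (G : WeightedGraph V) (s : V → ℝ) : ℝ :=
  G.polarization s + G.disagreement s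

/-- `I + L` is invertible, so the inverse in `equilibrium` is a genuine one. -/
theorem isUnit_det_one_add_laplacian (G : WeightedGraph V) :
    IsUnit (1 + G.laplacian).det := by
  rw [isUnit_iff_ne_zero]
  intro h
  obtain ⟨x, hx, h0⟩ := Matrix.exists_mulVec_eq_zero_iff.mpr h
  have hrow : ∀ u, x u + ((∑ v, G.w u v) * x u - ∑ v, G.w u v * x v) = 0 := by
    intro u
    have := congrFun h0 u
    rw [laplacian, Matrix.add_mulVec, Matrix.one_mulVec, Matrix.sub_mulVec] at this
    simp only [Pi.add_apply, Pi.sub_apply, Matrix.mulVec_diagonal, Pi.zero_apply] at this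
    exact this
  obtain ⟨u, hu⟩ := Function.ne_iff.mp hx
  have key : ∑ u, x u ^ 2 + (1 / 2) * ∑ u, ∑ v, G.w u v * (x u - x v) ^ 2 = 0 := by
    have e1 : ∑ u, ∑ v, G.w u v * (x v) ^ 2 = ∑ u, ∑ v, G.w u v * (x u) ^ 2 := by
      rw [Finset.sum_comm]
      exact Finset.sum_congr rfl fun a _ => Finset.sum_congr rfl fun b _ => by rw [G.symm]
    have e2 : ∑ u, ∑ v, G.w u v * (x u - x v) ^ 2 =
        ∑ u, ∑ v, G.w u v * (x u) ^ 2 + ∑ u, ∑ v, G.w u v * (x v) ^ 2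
          - 2 * ∑ u, ∑ v, G.w u v * (x u * x v) := by
      simp only [Finset.mul_sum, ← Finset.sum_add_distrib, ← Finset.sum_sub_distrib]
      exact Finset.sum_congr rfl fun a _ => Finset.sum_congr rfl fun b _ => by ring
    rw [e2, e1]
    have e3 : ∑ u, x u * (x u + ((∑ v, G.w u v) * x u - ∑ v, G.w u v * x v)) = 0 := by
      simp [hrow]
    have e4 : ∑ u, x u * (x u + ((∑ v, G.w u v) * x u - ∑ v, G.w u v * x v)) =
        ∑ u, x u ^ 2 + (∑ u, ∑ v, G.w u v * (x u) ^ 2 - ∑ u, ∑ v, G.w u v * (x u * x v)) := by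
      simp only [← Finset.sum_add_distrib, ← Finset.sum_sub_distrib]
      refine Finset.sum_congr rfl fun a _ => ?_
      simp only [Finset.sum_sub_distrib, mul_add, mul_sub, Finset.mul_sum, Finset.sum_mul]
      congr 1
      · ring
      · congr 1 <;> exact Finset.sum_congr rfl fun b _ => by ring
    linarith
  have p1 : 0 < ∑ u, x u ^ 2 :=
    Finset.sum_pos' (fun _ _ => sq_nonneg _) ⟨u, Finset.mem_univ _, by
      have : x u ≠ 0 := hu
      positivity⟩
  have p2 : 0 ≤ ∑ u, ∑ v, G.w u v * (x u - x v) ^ 2 :=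
    Finset.sum_nonneg fun a _ => Finset.sum_nonneg fun b _ =>
      mul_nonneg (G.nonneg a b) (sq_nonneg _)
  linarith

end WeightedGraph

/-- The feasible set of the topology problem: the connected weighted graphs on `V` of total edge
weight `m`. -/
def feasibleGraphs (V : Type*) [Fintype V] (m : ℝ) : Set (WeightedGraph V) :=
  {G | G.toSimpleGraph.Connected ∧ G.totalWeight = m}

/-- The optimal value of the topology problem: the infimum of the polarization-disagreement index
over all connected weighted graphs of total edge weight `m`. -/
noncomputable def optimalIndex {V : Type*} [Fintype V] [DecidableEq V] (m : ℝ) (s : V → ℝ) : ℝ :=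
  sInf ((fun G : WeightedGraph V => G.pdIndex s) '' feasibleGraphs V m)

namespace WeightedGraph

/-! The index depends on the graph only through its equilibrium `z`, because the disagreement is `z
⬝ᵥ L z = z ⬝ᵥ (s - z)` (`pdIndex_eq`). For fixed `z`, being the equilibrium means `L z = s - z`,
which is linear in the edge weights. So no spectral sparsification is needed: for `z` the
equilibrium of a near-optimal graph, Carathéodory's theorem yields at most `n + 1` edges with the
same total weight and the same `L z`, hence exactly the same index (`exists_sparse_pdIndex_eq`).

The sparse graph may be disconnected. Mixing in a little of a star repairs this, and by continuity
the index stays below `(1 + ε) * OPT`, provided `OPT > 0` (`optimalIndex_pos`). For constant `s`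
every index is zero. In total there are at most `2 * n` edges. -/

theorem degree_le_two_mul_totalWeight {V : Type*} [Fintype V] (G : WeightedGraph V)
    (u : V) :
    ∑ v, G.w u v ≤ 2 * G.totalWeight := by
  have h := Finset.single_le_sum (f := fun u => ∑ v, G.w u v)
    (fun i _ => Finset.sum_nonneg fun j _ => G.nonneg i j) (Finset.mem_univ u)
  rw [totalWeight]
  linarith

/-! ### The equilibrium and the index in terms of the Laplacian. -/

section Laplacian

variable {V : Type*} [Fintype V] [DecidableEq V]

theorem laplacian_mulVec (G : WeightedGraph V) (x : V → ℝ) (u : V) :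
    (G.laplacian *ᵥ x) u = ∑ v, G.w u v * (x u - x v) := by
  rw [laplacian, Matrix.sub_mulVec]
  simp only [Pi.sub_apply, Matrix.mulVec_diagonal]
  simp only [mul_sub, Finset.sum_sub_distrib, Finset.sum_mul]
  rfl

theorem one_add_laplacian_mulVec_equilibrium (G : WeightedGraph V) (s : V → ℝ) :
    (1 + G.laplacian) *ᵥ G.equilibrium s = s := by
  rw [equilibrium, Matrix.mulVec_mulVec, Matrix.mul_nonsing_inv _ G.isUnit_det_one_add_laplacian,
    Matrix.one_mulVec]

theorem equilibrium_eq_of_mulVec_eq (G : WeightedGraph V) {s z : V → ℝ}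
    (h : (1 + G.laplacian) *ᵥ z = s) : G.equilibrium s = z := by
  rw [equilibrium, ← h, Matrix.mulVec_mulVec,
    Matrix.nonsing_inv_mul _ G.isUnit_det_one_add_laplacian, Matrix.one_mulVec]

theorem laplacian_mulVec_equilibrium (G : WeightedGraph V) (s : V → ℝ) :
    G.laplacian *ᵥ G.equilibrium s = s - G.equilibrium s := by
  have h := G.one_add_laplacian_mulVec_equilibrium s
  rw [Matrix.add_mulVec, Matrix.one_mulVec] at h
  exact eq_sub_of_add_eq' h

theorem half_sum_sq_eq_dotProduct (G : WeightedGraph V) (x : V → ℝ) :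
    (1 / 2) * ∑ u, ∑ v, G.w u v * (x u - x v) ^ 2 = x ⬝ᵥ (G.laplacian *ᵥ x) := by
  have e : ∑ u, ∑ v, G.w u v * (x u - x v) * x v
      = - ∑ u, ∑ v, G.w u v * (x u - x v) * x u := by
    rw [Finset.sum_comm, ← Finset.sum_neg_distrib]
    refine Finset.sum_congr rfl fun a _ => ?_
    rw [← Finset.sum_neg_distrib]
    exact Finset.sum_congr rfl fun b _ => by rw [G.symm b a]; ring
  have e2 : ∑ u, ∑ v, G.w u v * (x u - x v) ^ 2 =
      ∑ u, ∑ v, G.w u v * (x u - x v) * x u - ∑ u, ∑ v, G.w u v * (x u - x v) * x v := by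
    simp only [← Finset.sum_sub_distrib]
    exact Finset.sum_congr rfl fun a _ => Finset.sum_congr rfl fun b _ => by ring
  have e3 : x ⬝ᵥ (G.laplacian *ᵥ x) = ∑ u, ∑ v, G.w u v * (x u - x v) * x u := by
    simp only [dotProduct, laplacian_mulVec, Finset.mul_sum]
    exact Finset.sum_congr rfl fun a _ => Finset.sum_congr rfl fun b _ => by ring
  rw [e2, e, e3]
  ring

/-- The polarization-disagreement index as a function of the equilibrium alone. -/
theorem pdIndex_eq (G : WeightedGraph V) (s : V → ℝ) :
    G.pdIndex s = ∑ u, (G.equilibrium s u - (∑ v, G.equilibrium s v) / (Fintype.card V : ℝ)) ^ 2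
      + G.equilibrium s ⬝ᵥ (s - G.equilibrium s) := by
  rw [pdIndex, disagreement, half_sum_sq_eq_dotProduct, laplacian_mulVec_equilibrium]
  rfl

theorem pdIndex_congr {G H : WeightedGraph V} {s : V → ℝ}
    (h : G.equilibrium s = H.equilibrium s) : G.pdIndex s = H.pdIndex s := by
  rw [pdIndex_eq, pdIndex_eq, h]

theorem disagreement_nonneg (G : WeightedGraph V) (s : V → ℝ) : 0 ≤ G.disagreement s :=
  mul_nonneg (by norm_num) <| Finset.sum_nonneg fun a _ => Finset.sum_nonneg fun b _ =>
    mul_nonneg (G.nonneg a b) (sq_nonneg _)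

theorem polarization_nonneg (G : WeightedGraph V) (s : V → ℝ) : 0 ≤ G.polarization s :=
  Finset.sum_nonneg fun _ _ => sq_nonneg _

theorem pdIndex_nonneg (G : WeightedGraph V) (s : V → ℝ) : 0 ≤ G.pdIndex s :=
  add_nonneg (G.polarization_nonneg s) (G.disagreement_nonneg s)

theorem pdIndex_const [Nonempty V] (G : WeightedGraph V) (c : ℝ) :
    G.pdIndex (fun _ => c) = 0 := by
  have h : G.equilibrium (fun _ => c) = fun _ => c := by
    refine G.equilibrium_eq_of_mulVec_eq ?_
    rw [Matrix.add_mulVec, Matrix.one_mulVec]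
    ext u
    simp [laplacian_mulVec]
  have hV : (Fintype.card V : ℝ) ≠ 0 := Nat.cast_ne_zero.mpr Fintype.card_ne_zero
  rw [pdIndex_eq, h]
  simp [dotProduct, mul_div_cancel_left₀ _ hV]

/-- Opinion gaps shrink at equilibrium by at most a factor depending on the total weight. -/
theorem abs_sub_le_mul_sqrt_pdIndex (G : WeightedGraph V) (s : V → ℝ) (u v : V) :
    |s u - s v| ≤ 2 * (1 + 4 * G.totalWeight) * √(G.pdIndex s) := by
  set R := √(G.pdIndex s) with hR
  have hR0 : 0 ≤ R := Real.sqrt_nonneg _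
  set μ := (∑ v, G.equilibrium s v) / (Fintype.card V : ℝ) with hμ
  have hz : ∀ a, |G.equilibrium s a - μ| ≤ R := by
    intro a
    refine Real.abs_le_sqrt ?_
    have h1 : (G.equilibrium s a - μ) ^ 2 ≤ G.polarization s :=
      Finset.single_le_sum (f := fun a => (G.centeredEquilibrium s a) ^ 2)
        (fun _ _ => sq_nonneg _) (Finset.mem_univ a)
    exact h1.trans (le_add_of_nonneg_right (G.disagreement_nonneg s))
  -- Since `s = z + L z`, the deviation is at most `R` plus the degree, at most twice the total
  -- weight, times the largest gap `2 * R`.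
  have hs : ∀ a, |s a - μ| ≤ (1 + 4 * G.totalWeight) * R := by
    intro a
    have h1 : s a - μ = (G.equilibrium s a - μ)
        + ∑ b, G.w a b * (G.equilibrium s a - G.equilibrium s b) := by
      have := congrFun (G.laplacian_mulVec_equilibrium s) a
      rw [laplacian_mulVec] at this
      rw [this, Pi.sub_apply]
      ring
    have h2 : |∑ b, G.w a b * (G.equilibrium s a - G.equilibrium s b)|
        ≤ ∑ b, G.w a b * (2 * R) := by
      refine (Finset.abs_sum_le_sum_abs _ _).trans (Finset.sum_le_sum fun b _ => ?_)
      rw [abs_mul, abs_of_nonneg (G.nonneg a b)]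
      refine mul_le_mul_of_nonneg_left ?_ (G.nonneg a b)
      have := abs_sub_le (G.equilibrium s a) μ (G.equilibrium s b)
      rw [abs_sub_comm μ] at this
      linarith [hz a, hz b]
    rw [← Finset.sum_mul] at h2
    have h3 := mul_le_mul_of_nonneg_right (G.degree_le_two_mul_totalWeight a)
      (by positivity : 0 ≤ 2 * R)
    rw [h1]
    refine (abs_add_le _ _).trans ?_
    linarith [hz a]
  have := abs_sub_le (s u) μ (s v)
  rw [abs_sub_comm μ] at this
  linarith [hs u, hs v]

end Laplacian

/-! ### Graphs given by a list of weighted edges. -/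

section OfFamily

variable {V ι : Type*} [DecidableEq V] [Fintype ι]

/-- The weighted graph with an edge `{a i, b i}` of weight `c i` for every index `i`, the weights of
parallel edges being added. -/
def ofFamily (a b : ι → V) (c : ι → ℝ) (hab : ∀ i, a i ≠ b i) (hc : ∀ i, 0 ≤ c i) :
    WeightedGraph V where
  w u v := ∑ i, if s(a i, b i) = s(u, v) then c i else 0
  symm u v := by rw [Sym2.eq_swap]
  nonneg u v := Finset.sum_nonneg fun i _ => by split_ifs <;> simp [hc]
  loopless u := Finset.sum_eq_zero fun i _ => by
    rw [if_neg]
    intro h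
    rcases Sym2.eq_iff.mp h with ⟨h1, h2⟩ | ⟨h1, h2⟩ <;> exact hab i (h1.trans h2.symm)

variable {a b : ι → V} {c : ι → ℝ} (hab : ∀ i, a i ≠ b i) (hc : ∀ i, 0 ≤ c i)

theorem numEdges_ofFamily_le : (ofFamily a b c hab hc).numEdges ≤ Fintype.card ι := by
  have h : (ofFamily a b c hab hc).toSimpleGraph.edgeSet ⊆ Set.range fun i => s(a i, b i) := by
    intro e
    induction e with
    | h u v =>
      intro (h : 0 < ∑ i, if s(a i, b i) = s(u, v) then c i else 0)
      obtain ⟨i, -, hi⟩ := Finset.exists_ne_zero_of_sum_ne_zero h.ne'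
      exact ⟨i, by by_contra hne; exact hi (if_neg hne)⟩
  refine (Set.ncard_le_ncard h (Set.finite_range _)).trans ?_
  rw [← Set.image_univ, ← Nat.card_eq_fintype_card, ← Set.ncard_univ]
  exact Set.ncard_image_le Set.finite_univ

theorem ofFamily_adj {i : ι} (hi : 0 < c i) :
    (ofFamily a b c hab hc).toSimpleGraph.Adj (a i) (b i) := by
  change 0 < ∑ j, if s(a j, b j) = s(a i, b i) then c j else 0
  refine Finset.sum_pos' (fun j _ => ?_) ⟨i, Finset.mem_univ i, by simpa using hi⟩
  split_ifs
  exacts [hc j, le_rfl]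

variable [Fintype V]

/-- Edge `i` meets row `u` at either endpoint, and `hab` keeps the two cases disjoint. Taking `f =
1` gives degrees; `f u v = z u - z v` gives the Laplacian. -/
theorem sum_ofFamily_mul (f : V → V → ℝ) (u : V) :
    ∑ v, (ofFamily a b c hab hc).w u v * f u v =
      ∑ i, c i * ((if u = a i then f (a i) (b i) else 0)
        + (if u = b i then f (b i) (a i) else 0)) := by
  change ∑ v, (∑ i, if s(a i, b i) = s(u, v) then c i else 0) * f u v = _
  simp only [Finset.sum_mul]
  rw [Finset.sum_comm]
  refine Finset.sum_congr rfl fun i _ => ?_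
  have h : ∀ v, (if s(a i, b i) = s(u, v) then c i else 0) * f u v =
      (if v = b i then c i * (if u = a i then f (a i) (b i) else 0) else 0)
        + (if v = a i then c i * (if u = b i then f (b i) (a i) else 0) else 0) := by
    intro v
    have := hab i
    simp only [Sym2.eq_iff]
    grind
  simp only [h, Finset.sum_add_distrib, Finset.sum_ite_eq', Finset.mem_univ, if_true, mul_add]

theorem totalWeight_ofFamily : (ofFamily a b c hab hc).totalWeight = ∑ i, c i := by
  have h := fun u => sum_ofFamily_mul hab hc (fun _ _ => 1) u
  simp only [mul_one] at h
  simp only [totalWeight, h]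
  rw [Finset.sum_comm]
  simp only [← Finset.mul_sum, Finset.sum_add_distrib, Finset.sum_ite_eq', Finset.mem_univ,
    if_true]
  rw [← Finset.sum_mul]
  ring

end OfFamily

/-! ### Convex combinations of graphs and continuity of the index. -/

section Mix

variable {V : Type*}

/-- The convex combination `(1 - t) G + t H` of two weighted graphs. -/
def mix (G H : WeightedGraph V) (t : ℝ) (h0 : 0 ≤ t) (h1 : t ≤ 1) : WeightedGraph V where
  w u v := (1 - t) * G.w u v + t * H.w u v
  symm u v := by rw [G.symm, H.symm]
  nonneg u v := add_nonneg (mul_nonneg (sub_nonneg.mpr h1) (G.nonneg u v))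
    (mul_nonneg h0 (H.nonneg u v))
  loopless u := by simp [G.loopless, H.loopless]

variable (G H : WeightedGraph V) {t : ℝ}

theorem connected_mix (h0 : 0 < t) (h1 : t ≤ 1) (hH : H.toSimpleGraph.Connected) :
    (mix G H t h0.le h1).toSimpleGraph.Connected :=
  hH.mono fun u v (h : 0 < H.w u v) =>
    add_pos_of_nonneg_of_pos (mul_nonneg (sub_nonneg.mpr h1) (G.nonneg u v)) (mul_pos h0 h)

variable [Fintype V]

theorem totalWeight_mix (h0 : 0 ≤ t) (h1 : t ≤ 1) :
    (mix G H t h0 h1).totalWeight = (1 - t) * G.totalWeight + t * H.totalWeight := by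
  simp only [totalWeight, mix, Finset.sum_add_distrib, ← Finset.mul_sum]
  ring

theorem numEdges_mix_le (h0 : 0 ≤ t) (h1 : t ≤ 1) :
    (mix G H t h0 h1).numEdges ≤ G.numEdges + H.numEdges := by
  have h : (mix G H t h0 h1).toSimpleGraph.edgeSet ⊆
      G.toSimpleGraph.edgeSet ∪ H.toSimpleGraph.edgeSet := by
    intro e
    induction e with
    | h u v =>
      intro (h : 0 < (1 - t) * G.w u v + t * H.w u v)
      by_contra hne
      simp only [Set.mem_union, SimpleGraph.mem_edgeSet, not_or] at hne
      have e1 : G.w u v = 0 := le_antisymm (not_lt.mp hne.1) (G.nonneg u v)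
      have e2 : H.w u v = 0 := le_antisymm (not_lt.mp hne.2) (H.nonneg u v)
      simp [e1, e2] at h
  exact (Set.ncard_le_ncard h (Set.toFinite _)).trans (Set.ncard_union_le _ _)

variable [DecidableEq V]

theorem laplacian_mix (h0 : 0 ≤ t) (h1 : t ≤ 1) :
    (mix G H t h0 h1).laplacian = (1 - t) • G.laplacian + t • H.laplacian := by
  ext u v
  by_cases huv : u = v
  · subst huv
    simp [laplacian, mix, Finset.sum_add_distrib, ← Finset.mul_sum]
    ring
  · simp [laplacian, mix, huv]
    ring

/-- Mixing in a little of another graph changes the index only a little. -/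
theorem exists_pdIndex_mix_lt (s : V → ℝ) {B : ℝ} (hB : G.pdIndex s < B) :
    ∃ (t : ℝ) (h0 : 0 < t) (h1 : t ≤ 1), (mix G H t h0.le h1).pdIndex s < B := by
  -- `M`, `z` and `F` make sense for every real `t`, unlike `mix`, so two-sided continuity at `0`
  -- can be used.
  let M : ℝ → Matrix V V ℝ := fun t => 1 + ((1 - t) • G.laplacian + t • H.laplacian)
  let z : ℝ → V → ℝ := fun t => (M t)⁻¹ *ᵥ s
  let F : ℝ → ℝ := fun t =>
    ∑ u, (z t u - (∑ v, z t v) / (Fintype.card V : ℝ)) ^ 2 + z t ⬝ᵥ (s - z t)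
  have hM0 : M 0 = 1 + G.laplacian := by simp [M]
  have hM : Continuous M := by fun_prop
  have hinv : ContinuousAt (fun t => (M t)⁻¹) 0 := by
    simp only [Matrix.inv_def, Ring.inverse_eq_inv']
    refine ContinuousAt.smul (ContinuousAt.inv₀ hM.matrix_det.continuousAt ?_)
      hM.matrix_adjugate.continuousAt
    rw [hM0]
    exact G.isUnit_det_one_add_laplacian.ne_zero
  have hz : ContinuousAt z 0 :=
    (Continuous.matrix_mulVec continuous_id continuous_const).continuousAt.comp hinv
  have hF : ContinuousAt F 0 := by
    have hzu : ∀ u, ContinuousAt (fun t => z t u) 0 := fun u => continuousAt_pi.mp hz u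
    simp only [F, dotProduct, Pi.sub_apply]
    fun_prop
  have hF0 : F 0 < B := by
    have : F 0 = G.pdIndex s := by
      simp only [F, z, hM0, pdIndex_eq]
      rfl
    rwa [this]
  have hev := (hF.eventually (gt_mem_nhds hF0)).filter_mono (nhdsWithin_le_nhds (s := Set.Ioi 0))
  obtain ⟨t, htB, ht0, ht1⟩ := (hev.and (Ioc_mem_nhdsGT (zero_lt_one' ℝ))).exists
  refine ⟨t, ht0, ht1, ?_⟩
  have : (mix G H t (le_of_lt ht0) ht1).pdIndex s = F t := by
    simp only [F, z, M, pdIndex_eq, equilibrium, laplacian_mix]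
  rwa [this]

end Mix

/-! ### Sparsification by Carathéodory's theorem, and the star. -/

section Sparsify

variable {V : Type*} [Fintype V] [DecidableEq V]

/-- By Carathéodory's theorem, a weighted graph can be replaced by one with at most `|V| + 1` edges,
keeping the total weight and the image of a given vector under the Laplacian. -/
theorem exists_sparse_laplacian_mulVec_eq (H : WeightedGraph V) (hH : 0 < H.totalWeight)
    (z : V → ℝ) :
    ∃ G : WeightedGraph V, G.totalWeight = H.totalWeight ∧
      G.laplacian *ᵥ z = H.laplacian *ᵥ z ∧ G.numEdges ≤ Fintype.card V + 1 := by
  set m := H.totalWeight with hm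
  -- `p e` is `L z` for the graph whose only edge is `e`, with weight `m`.
  let p : V × V → V → ℝ := fun e x =>
    m * ((if x = e.1 then z e.1 - z e.2 else 0) + (if x = e.2 then z e.2 - z e.1 else 0))
  let T : Finset (V × V) := Finset.univ.filter fun e => e.1 ≠ e.2
  have hT : ∀ f : V × V → ℝ, ∑ e ∈ T, H.w e.1 e.2 * f e = ∑ u, ∑ v, H.w u v * f (u, v) := by
    intro f
    rw [← Fintype.sum_prod_type' (f := fun u v => H.w u v * f (u, v))]
    refine Finset.sum_filter_of_ne fun e _ he heq => he ?_
    rw [heq, H.loopless, zero_mul]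
  have hmem : H.laplacian *ᵥ z ∈ convexHull ℝ (p '' (T : Set (V × V))) := by
    -- `T` consists of ordered pairs, so each edge occurs twice; hence the factor `2`.
    have hw : ∑ e ∈ T, H.w e.1 e.2 / (2 * m) = 1 := by
      have := hT fun _ => 1
      simp only [mul_one] at this
      rw [← Finset.sum_div, this, div_eq_one_iff_eq (by positivity), hm, totalWeight]
      ring
    have hsum : H.laplacian *ᵥ z = ∑ e ∈ T, (H.w e.1 e.2 / (2 * m)) • p e := by
      ext x
      have h1 : (∑ e ∈ T, (H.w e.1 e.2 / (2 * m)) • p e) x =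
          ∑ e ∈ T, H.w e.1 e.2 * (1 / 2 * ((if x = e.1 then z e.1 - z e.2 else 0)
            + (if x = e.2 then z e.2 - z e.1 else 0))) := by
        rw [Finset.sum_apply]
        refine Finset.sum_congr rfl fun e _ => ?_
        simp only [p, Pi.smul_apply, smul_eq_mul]
        field_simp
      have h2 : ∑ u, ∑ v, H.w u v * (1 / 2 * (if x = u then z u - z v else 0))
          = 1 / 2 * ∑ v, H.w x v * (z x - z v) := by
        rw [Finset.sum_comm, Finset.mul_sum]
        refine Finset.sum_congr rfl fun v _ => ?_
        simp only [mul_ite, mul_zero, Finset.sum_ite_eq, Finset.mem_univ, if_true]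
        ring
      have h3 : ∑ u, ∑ v, H.w u v * (1 / 2 * (if x = v then z v - z u else 0))
          = 1 / 2 * ∑ v, H.w x v * (z x - z v) := by
        rw [Finset.mul_sum]
        refine Finset.sum_congr rfl fun v _ => ?_
        simp only [mul_ite, mul_zero, Finset.sum_ite_eq, Finset.mem_univ, if_true]
        rw [H.symm v x]
        ring
      rw [h1, hT fun e => 1 / 2 * ((if x = e.1 then z e.1 - z e.2 else 0)
            + (if x = e.2 then z e.2 - z e.1 else 0)), laplacian_mulVec]
      simp only [mul_add, Finset.sum_add_distrib] at h2 h3 ⊢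
      rw [h2, h3]
      ring
    rw [hsum]
    exact (convex_convexHull ℝ _).sum_mem
      (fun e _ => div_nonneg (H.nonneg _ _) (by positivity)) hw
      fun e he => subset_convexHull ℝ _ ⟨e, he, rfl⟩
  obtain ⟨ι, _, q, c, hq, hind, hc, hc1, hcq⟩ := eq_pos_convex_span_of_mem_convexHull hmem
  have hsel : ∀ i, ∃ e : V × V, e.1 ≠ e.2 ∧ p e = q i := by
    intro i
    obtain ⟨e, he, hpe⟩ := hq ⟨i, rfl⟩
    exact ⟨e, by simpa [T] using he, hpe⟩
  choose e hne hpe using hsel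
  have hmc : ∀ i, 0 ≤ m * c i := fun i => mul_nonneg hH.le (hc i).le
  refine ⟨ofFamily (fun i => (e i).1) (fun i => (e i).2) (fun i => m * c i) hne hmc, ?_, ?_, ?_⟩
  · rw [totalWeight_ofFamily, ← Finset.mul_sum, hc1, mul_one]
  · rw [← hcq]
    ext x
    rw [laplacian_mulVec, sum_ofFamily_mul hne hmc (fun u v => z u - z v), Finset.sum_apply]
    refine Finset.sum_congr rfl fun i _ => ?_
    rw [← hpe i]
    simp only [p, Pi.smul_apply, smul_eq_mul]
    ring
  · refine (numEdges_ofFamily_le hne hmc).trans (hind.card_le_finrank_succ.trans ?_)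
    refine Nat.succ_le_succ ((Submodule.finrank_le _).trans ?_)
    rw [Module.finrank_fintype_fun_eq_card]

/-- Every weighted graph has a sparse counterpart with the same total weight and index. -/
theorem exists_sparse_pdIndex_eq (H : WeightedGraph V) (hH : 0 < H.totalWeight) (s : V → ℝ) :
    ∃ G : WeightedGraph V, G.totalWeight = H.totalWeight ∧ G.pdIndex s = H.pdIndex s ∧
      G.numEdges ≤ Fintype.card V + 1 := by
  obtain ⟨G, h1, h2, h3⟩ := H.exists_sparse_laplacian_mulVec_eq hH (H.equilibrium s)
  refine ⟨G, h1, pdIndex_congr (G.equilibrium_eq_of_mulVec_eq ?_), h3⟩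
  rw [Matrix.add_mulVec, h2, ← Matrix.add_mulVec, one_add_laplacian_mulVec_equilibrium]

/-- A star is a connected graph with `|V| - 1` edges. -/
theorem exists_feasible_numEdges_lt [Nontrivial V] {m : ℝ} (hm : 0 < m) :
    ∃ G ∈ feasibleGraphs V m, G.numEdges + 1 ≤ Fintype.card V := by
  obtain ⟨r⟩ := (inferInstance : Nonempty V)
  obtain ⟨r', hr'⟩ := exists_ne r
  have : Nonempty {v : V // v ≠ r} := ⟨⟨r', hr'⟩⟩
  have hk : 0 < (Fintype.card {v : V // v ≠ r} : ℝ) := Nat.cast_pos.mpr Fintype.card_pos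
  have hne : ∀ v : {v : V // v ≠ r}, (v : V) ≠ r := fun v => v.2
  have hc := div_pos hm hk
  let G : WeightedGraph V := ofFamily (fun v : {v : V // v ≠ r} => (v : V)) (fun _ => r)
    (fun _ => m / Fintype.card {v : V // v ≠ r}) hne fun _ => hc.le
  have hreach : ∀ v, G.toSimpleGraph.Reachable v r := by
    intro v
    by_cases hv : v = r
    · rw [hv]
    · exact (ofFamily_adj hne (fun _ => hc.le) (i := ⟨v, hv⟩) hc).reachable
  refine ⟨G, ⟨⟨fun u v => (hreach u).trans (hreach v).symm⟩, ?_⟩, ?_⟩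
  · rw [totalWeight_ofFamily]
    simp only [Finset.sum_const, Finset.card_univ, nsmul_eq_mul]
    exact mul_div_cancel₀ m hk.ne'
  · have h1 := numEdges_ofFamily_le hne fun _ => hc.le
    have h2 : Fintype.card {v : V // v ≠ r} < Fintype.card V :=
      Fintype.card_subtype_lt (x := r) (by simp)
    exact Nat.succ_le_of_lt (h1.trans_lt h2)

end Sparsify

end WeightedGraph

/-! ### Positivity and approximation of the optimum. -/

section Optimum

open WeightedGraph

variable {V : Type*} [Fintype V] [DecidableEq V]

theorem optimalIndex_le {m : ℝ} {G : WeightedGraph V} (hG : G ∈ feasibleGraphs V m)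
    (s : V → ℝ) : optimalIndex m s ≤ G.pdIndex s :=
  csInf_le ⟨0, by rintro _ ⟨H, -, rfl⟩; exact H.pdIndex_nonneg s⟩ ⟨G, hG, rfl⟩

theorem optimalIndex_nonneg (m : ℝ) (s : V → ℝ) : 0 ≤ optimalIndex m s :=
  Real.sInf_nonneg (by rintro _ ⟨H, -, rfl⟩; exact H.pdIndex_nonneg s)

/-- The bound of `abs_sub_le_mul_sqrt_pdIndex` involves only `m` and `s`, so it is uniform over
feasible graphs and survives the infimum. -/
theorem optimalIndex_pos [Nontrivial V] {m : ℝ} (hm : 0 < m) {s : V → ℝ} {u v : V}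
    (huv : s u ≠ s v) : 0 < optimalIndex m s := by
  have hD : 0 < 2 * (1 + 4 * m) := by positivity
  have hd : 0 < |s u - s v| := abs_pos.mpr (sub_ne_zero.mpr huv)
  obtain ⟨G, hG, -⟩ := exists_feasible_numEdges_lt (V := V) hm
  refine lt_of_lt_of_le (pow_pos (div_pos hd hD) 2) (le_csInf ⟨_, G, hG, rfl⟩ ?_)
  rintro _ ⟨H, ⟨-, hH⟩, rfl⟩
  have h := H.abs_sub_le_mul_sqrt_pdIndex s u v
  rw [hH, ← div_le_iff₀' hD] at h
  exact (Real.le_sqrt' (div_pos hd hD)).mp h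

/-- The optimum is approximated to any accuracy by graphs with at most `2 |V|` edges. -/
theorem exists_sparse_pdIndex_le [Nontrivial V] {m : ℝ} (hm : 0 < m) (s : V → ℝ) {ε : ℝ}
    (hε : 0 < ε) :
    ∃ G ∈ feasibleGraphs V m, G.numEdges ≤ 2 * Fintype.card V ∧
      G.pdIndex s ≤ (1 + ε) * optimalIndex m s := by
  obtain ⟨T, hT, hTe⟩ := exists_feasible_numEdges_lt (V := V) hm
  by_cases hs : ∃ u v, s u ≠ s v
  · obtain ⟨u, v, huv⟩ := hs
    have hopt := optimalIndex_pos hm huv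
    -- This strict gap absorbs both the choice of `H` above the infimum and the later mixing with
    -- the star.
    have hlt : optimalIndex m s < (1 + ε) * optimalIndex m s := by nlinarith
    obtain ⟨_, ⟨H, hH, rfl⟩, hHB⟩ := exists_lt_of_csInf_lt (Set.Nonempty.image _ ⟨T, hT⟩) hlt
    obtain ⟨G, hG, hGs, hGe⟩ := H.exists_sparse_pdIndex_eq (hH.2.symm ▸ hm) s
    obtain ⟨t, h0, h1, ht⟩ := G.exists_pdIndex_mix_lt T s (hGs.trans_lt hHB)
    refine ⟨mix G T t h0.le h1, ⟨connected_mix G T h0 h1 hT.1, ?_⟩, ?_, ht.le⟩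
    · rw [totalWeight_mix, hG, hH.2, hT.2]
      ring
    · have := numEdges_mix_le G T h0.le h1
      omega
  · push Not at hs
    obtain ⟨r⟩ := (inferInstance : Nonempty V)
    have hconst : s = fun _ => s r := funext fun u => hs u r
    refine ⟨T, hT, by omega, ?_⟩
    have h0 : T.pdIndex s = 0 := by
      rw [hconst]
      exact T.pdIndex_const (s r)
    rw [h0]
    exact mul_nonneg (by positivity) (optimalIndex_nonneg m s)

end Optimum

theorem theorem3 :
    ∃ C K : ℝ, ∀ (n : ℕ), 2 ≤ n → ∀ (m : ℝ), 0 < m →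
      ∀ (s : Fin n → ℝ), (∀ i, s i ∈ Set.Icc (0 : ℝ) 1) →
      ∀ (ε : ℝ), 0 < ε → ε ≤ 1 →
      ∃ G ∈ feasibleGraphs (Fin n) m,
        (G.numEdges : ℝ) ≤ C * ((n : ℝ) * Real.log (n : ℝ) / ε ^ 2) ∧
        optimalIndex m s ≤ G.pdIndex s ∧
        G.pdIndex s ≤ (1 + ε + K * ε ^ 2) * optimalIndex m s := by
  -- `C = 4` suffices because `log n ≥ 1 / 2` and `ε ≤ 1` give `2 * n ≤ 4 * n * log n / ε ^ 2`; no
  -- quadratic error term arises, so `K = 0`.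
  refine ⟨4, 0, fun n hn m hm s _ ε hε hε1 => ?_⟩
  have : Nontrivial (Fin n) := Fin.nontrivial_iff_two_le.mpr hn
  obtain ⟨G, hG, he, hle⟩ := exists_sparse_pdIndex_le hm s hε
  refine ⟨G, hG, ?_, optimalIndex_le hG s, by simpa using hle⟩
  rw [Fintype.card_fin] at he
  have he' : (G.numEdges : ℝ) ≤ 2 * n := by exact_mod_cast he
  have hn' : (2 : ℝ) ≤ n := by exact_mod_cast hn
  have hlog : 1 / 2 ≤ Real.log n := by
    have h1 := Real.log_two_gt_d9
    have h2 := Real.log_le_log two_pos hn'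
    linarith
  have hnl : 0 ≤ (n : ℝ) * Real.log n := by positivity
  have hdiv : (n : ℝ) * Real.log n ≤ n * Real.log n / ε ^ 2 :=
    le_div_self hnl (by positivity) (pow_le_one₀ hε.le hε1)
  have hmul : (n : ℝ) * (1 / 2) ≤ n * Real.log n :=
    mul_le_mul_of_nonneg_left hlog (by positivity)
  linarith
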